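/- Let $0\le m\le n-1$ be integers, $R<\infty$, $0<\theta<\frac{\pi}{2}$, $0<b<\frac{1}{\sqrt{n-m}}$ and $\beta>n-m$. Let $G:=\{x\in\mathbb{R}^n: x_{m+1}=\dots=x_n=0\}$, let $d_G$ be the Euclidean distance to $G$, and set $E:=(-R,R)^n\setminus G$. For $x\in E$ let $x'$ be the point of $G$ nearest to $x$, $x'':=x-x'$ and $\omega(x''):=x''/\|x''\|$. Put $$\mathcal{C}_\theta(v;\omega):=\{y\in\mathbb{R}^n:(y-v)\cdot\omega>\cos\theta\,\|y-v\|\},$$ $$\Psi(x):=\{y\in E: 0<d_G(y)<b\,d_G(x)\}\cap\mathcal{C}_\theta(x';\omega(x'')),\qquad \Psi^{-1}(y):=\{x\in E:y\in\Psi(x)\}.$$ Let $c_{m,\theta}:=|\{y\in\mathbb{R}^n:0<d_G(y)<1\}\cap\mathcal{C}_\theta(0;e_n)|$, where $|\cdot|$ is Lebesgue measure and $e_n$ is the last coordinate vector, and $$K_4=K_4(m,n,\theta):=\frac{2^m\tan^m\theta}{c_{m,\theta}}\,\mathscr{H}^m(B^m)\,\mathscr{H}^{n-m-1}(S^{n-m-1}),$$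 where $B^m$ is the unit ball of $\mathbb{R}^m$ with its volume $\mathscr{H}^m(B^m)$ ($=1$ if $m=0$) and $S^{n-m-1}$ is the unit sphere of $\mathbb{R}^{n-m}$ with its surface area $\mathscr{H}^{n-m-1}(S^{n-m-1})$ ($=2$ if $n-m=1$). Suppose that $\gamma:E\to[0,\infty)$ is Lebesgue measurable and that, for some $K_3<\infty$, $1\le d_G(x)^\beta\gamma(x)\le K_3$ for all $x\in E$. Then $c_{m,\theta}>0$; $\Psi(x)$ is measurable with $0<|\Psi(x)|<\infty$ for every $x\in E$; and for every $y\in E$ the set $\Psi^{-1}(y)$ is measurable, $x\mapsto\gamma(x)/|\Psi(x)|$ is integrable on $\Psi^{-1}(y)$, and $$\int_{\Psi^{-1}(y)}\frac{\gamma(x)}{|\Psi(x)|}\,\mathrm{d}x\le\frac{K_3K_4}{n}\,b^{\beta-(n-m)}\,\gamma(y).$$ -/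

import Mathlib

open MeasureTheory Set

noncomputable section

namespace FlatCone

/-- The coordinate hyperplane of `ℝⁿ` on which the coordinates with index in `S` vanish. -/
def coordPlane {n : ℕ} (S : Set (Fin n)) : Set (EuclideanSpace ℝ (Fin n)) :=
  {x | ∀ i ∈ S, x i = 0}

/-- The `m`-dimensional coordinate plane `G = {x ∈ ℝⁿ : x_{m+1} = ⋯ = x_n = 0}`
(the coordinates are numbered from `0` here). -/
def plane (m n : ℕ) : Set (EuclideanSpace ℝ (Fin n)) :=
  coordPlane {i | m ≤ i.val}

/-- The punctured box `E = (-R, R)ⁿ \ G`. -/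
def box (m n : ℕ) (R : ℝ) : Set (EuclideanSpace ℝ (Fin n)) :=
  {x | ∀ i, x i ∈ Ioo (-R) R} \ plane m n

/-- The annular neighbourhood `A_I(S) = {x : d_S(x) ∈ I}`. -/
def annulus {n : ℕ} (I : Set ℝ) (S : Set (EuclideanSpace ℝ (Fin n))) :
    Set (EuclideanSpace ℝ (Fin n)) :=
  {x | Metric.infDist x S ∈ I}

/-- The open cone with vertex `x`, axis direction `ω` and aperture `2θ`. -/
def cone {n : ℕ} (θ : ℝ) (x ω : EuclideanSpace ℝ (Fin n)) : Set (EuclideanSpace ℝ (Fin n)) :=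
  {y | Real.cos θ * ‖y - x‖ < inner ℝ (y - x) ω}

/-- The metric projection `x'` of `x` on the plane `G` (see `proj_mem`, `dist_proj` and
`eq_proj_of_dist_eq`). -/
def proj (m : ℕ) {n : ℕ} (x : EuclideanSpace ℝ (Fin n)) : EuclideanSpace ℝ (Fin n) :=
  WithLp.toLp 2 fun i => if i.val < m then x i else 0

/-- The component `x'' = x - x'` of `x` orthogonal to `G`. -/
def perp (m : ℕ) {n : ℕ} (x : EuclideanSpace ℝ (Fin n)) : EuclideanSpace ℝ (Fin n) :=
  x - proj m x

/-- The direction `ω(v) = v / ‖v‖` of a nonzero vector. -/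
def dir {n : ℕ} (v : EuclideanSpace ℝ (Fin n)) : EuclideanSpace ℝ (Fin n) :=
  ‖v‖⁻¹ • v

/-- The correspondence `Ψ : E ↠ E`,
`Ψ(x) = E ∩ A_{(0, b d_G(x))}(G) ∩ C_θ(x'; ω(x''))`. -/
def Psi (m n : ℕ) (R θ b : ℝ) (x : EuclideanSpace ℝ (Fin n)) :
    Set (EuclideanSpace ℝ (Fin n)) :=
  box m n R ∩ annulus (Ioo 0 (b * Metric.infDist x (plane m n))) (plane m n) ∩
    cone θ (proj m x) (dir (perp m x))

/-- The inverse correspondence `Ψ⁻¹(y) = {x ∈ E : y ∈ Ψ(x)}`. -/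
def PsiInv (m n : ℕ) (R θ b : ℝ) (y : EuclideanSpace ℝ (Fin n)) :
    Set (EuclideanSpace ℝ (Fin n)) :=
  {x | x ∈ box m n R ∧ y ∈ Psi m n R θ b x}

/-- The last coordinate vector `e_n` of `ℝⁿ`. -/
def lastVec (n : ℕ) : EuclideanSpace ℝ (Fin n) :=
  WithLp.toLp 2 fun i => if i.val + 1 = n then 1 else 0

/-- The volume `c_{m,θ} = |A_{(0,1)}(G) ∩ C_θ(0; e_n)|`. -/
def coneVol (m n : ℕ) (θ : ℝ) : ℝ :=
  volume.real (annulus (Ioo 0 1) (plane m n) ∩ cone θ 0 (lastVec n))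

/-- The `m`-dimensional measure of the unit ball of `ℝᵐ` (it is `1` for `m = 0`). -/
def ballVol (m : ℕ) : ℝ :=
  volume.real (Metric.ball (0 : EuclideanSpace ℝ (Fin m)) 1)

/-- The surface measure of the unit sphere of `ℝᵏ` (it is `2` for `k = 1`). -/
def sphereArea (k : ℕ) : ℝ :=
  (volume : Measure (EuclideanSpace ℝ (Fin k))).toSphere.real univ

/-- The constant `K₄(m, n, θ)`. -/
def K4 (m n : ℕ) (θ : ℝ) : ℝ :=
  2 ^ m * Real.tan θ ^ m / coneVol m n θ * ballVol m * sphereArea (n - m)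

theorem proj_mem (m : ℕ) {n : ℕ} (x : EuclideanSpace ℝ (Fin n)) : proj m x ∈ plane m n := by
  intro i hi
  have : ¬ i.val < m := not_lt.mpr hi
  simp [proj, this]

theorem dist_sq_eq (m : ℕ) {n : ℕ} (x z : EuclideanSpace ℝ (Fin n)) (hz : z ∈ plane m n) :
    dist x z ^ 2 = dist x (proj m x) ^ 2 + dist (proj m x) z ^ 2 := by
  rw [EuclideanSpace.dist_eq, EuclideanSpace.dist_eq, EuclideanSpace.dist_eq,
    Real.sq_sqrt (by positivity), Real.sq_sqrt (by positivity), Real.sq_sqrt (by positivity),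
    ← Finset.sum_add_distrib]
  refine Finset.sum_congr rfl fun i _ => ?_
  by_cases h : i.val < m
  · simp [proj, h]
  · simp [proj, h, hz i (not_lt.mp h)]

theorem dist_proj (m : ℕ) {n : ℕ} (x : EuclideanSpace ℝ (Fin n)) :
    dist x (proj m x) = Metric.infDist x (plane m n) := by
  refine le_antisymm ?_ (Metric.infDist_le_dist_of_mem (proj_mem m x))
  refine (Metric.le_infDist ⟨_, proj_mem m x⟩).2 fun z hz => ?_
  refine (sq_le_sq₀ dist_nonneg dist_nonneg).1 ?_
  rw [dist_sq_eq m x z hz]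
  exact le_add_of_nonneg_right (sq_nonneg _)

theorem eq_proj_of_dist_eq (m : ℕ) {n : ℕ} (x z : EuclideanSpace ℝ (Fin n))
    (hz : z ∈ plane m n) (h : dist x z = Metric.infDist x (plane m n)) : z = proj m x := by
  have h1 := dist_sq_eq m x z hz
  rw [h, ← dist_proj] at h1
  have h2 : dist (proj m x) z ^ 2 = 0 := by linarith
  exact (dist_eq_zero.1 (pow_eq_zero_iff two_ne_zero |>.1 h2)).symm

end FlatCone

end

/-!
Write `n = m + k` and split `x = (a, z)`, `y = (u, w)` in `ℝᵐ × ℝᵏ`, so that `d_G(x) = ‖z‖`; put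
`r = ‖z‖`, `s = ‖w‖`, `T = tan θ`. For fixed directions, a cone with vertex in `G` and axis
orthogonal to `G` has as its section over `v ∈ ℝᵏ` the ball of radius `radius θ ω v ≤ T ‖v‖` about
the vertex (`join_mem_cone`, `radius_le`). Hence `y ∈ Ψ(x)` forces `s < b r`, `w · z > 0` and
`a ∈ Q(z)`, where `Q(z)` is the intersection of the cube `(-R, R)ᵐ` with the ball of radius
`radius θ (dir z) w ≤ T s` about `u`.

The cone may be truncated by the cube when `θ` is close to `π / 2`, so `|Ψ(x)|` cannot be
compared directly with the volume `(b r)ⁿ c` of the full cone, `c = coneVol m n θ`. It is compared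
with `|Q(z)|` instead: the cube is convex, so shrinking `Q(z)` towards `a ∈ Q(z)` places a
scaled copy of it in every nonempty section of `Ψ(x)` (`ofReal_pow_mul_volume_le`). Integrating
over the sections, with rotation and scaling of the full cone, gives (`le_volume_Psi`)
`|Ψ(x)| ≥ |Q(z)| · min(1, b r / (2 s))ᵐ (b r)ᵏ c / (|Bᵐ| Tᵐ)`.

In the integral over `Ψ⁻¹(y)` the factor `|Q(z)|` cancels against the integration in `a`
(`setLIntegral_PsiInv_le`). What remains is a radial integral over the part of the half-space
`w · z > 0` with `‖z‖ > s / b`. The half-space contributes a factor `1 / 2`, and as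
`min(1, t)⁻ᵐ ≤ 1 + t⁻ᵐ`, polar coordinates reduce the claim to
`1 / β + 2ᵐ / (β + m) ≤ 2ᵐ⁺¹ / n`, which holds for `β > k ≥ 1`
(`one_div_add_two_pow_div_le`, `setLIntegral_PsiInv_le_ofReal`).
-/

namespace FlatCone

open Metric
open scoped Pointwise ENNReal

variable {m k : ℕ}

/-! ### Splitting `ℝᵐ⁺ᵏ` as `ℝᵐ × ℝᵏ` -/

/-- The point of `ℝᵐ⁺ᵏ` whose first `m` coordinates are `p.1` and whose last `k` are `p.2`. -/
noncomputable def join {m k : ℕ} (p : EuclideanSpace ℝ (Fin m) × EuclideanSpace ℝ (Fin k)) :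
    EuclideanSpace ℝ (Fin (m + k)) :=
  WithLp.toLp 2 (Fin.append p.1.ofLp p.2.ofLp)

@[simp]
theorem join_castAdd (p : EuclideanSpace ℝ (Fin m) × EuclideanSpace ℝ (Fin k)) (i : Fin m) :
    join p (Fin.castAdd k i) = p.1 i := by
  simp [join]

@[simp]
theorem join_natAdd (p : EuclideanSpace ℝ (Fin m) × EuclideanSpace ℝ (Fin k)) (i : Fin k) :
    join p (Fin.natAdd m i) = p.2 i := by
  simp [join]

theorem measurePreserving_join :
    MeasurePreserving (join : EuclideanSpace ℝ (Fin m) × EuclideanSpace ℝ (Fin k) → _) := by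
  have h1 := (PiLp.volume_preserving_ofLp (Fin m)).prod (PiLp.volume_preserving_ofLp (Fin k))
  have h2 := (volume_measurePreserving_sumPiEquivProdPi (fun _ : Fin m ⊕ Fin k => ℝ)).symm
  have h3 := volume_measurePreserving_piCongrLeft (fun _ : Fin (m + k) => ℝ) finSumFinEquiv
  have h4 := PiLp.volume_preserving_toLp (Fin (m + k))
  convert h4.comp (h3.comp (h2.comp h1)) using 1
  swap
  · rfl
  funext p
  ext i
  refine Fin.addCases (fun i => ?_) (fun i => ?_) i
  · have := MeasurableEquiv.piCongrLeft_apply_apply (β := fun _ : Fin (m + k) => ℝ)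
      finSumFinEquiv ((MeasurableEquiv.sumPiEquivProdPi (fun _ : Fin m ⊕ Fin k => ℝ)).symm
        (p.1.ofLp, p.2.ofLp)) (Sum.inl i)
    rw [join_castAdd, ← finSumFinEquiv_apply_left]
    exact this.symm
  · have := MeasurableEquiv.piCongrLeft_apply_apply (β := fun _ : Fin (m + k) => ℝ)
      finSumFinEquiv ((MeasurableEquiv.sumPiEquivProdPi (fun _ : Fin m ⊕ Fin k => ℝ)).symm
        (p.1.ofLp, p.2.ofLp)) (Sum.inr i)
    rw [join_natAdd, ← finSumFinEquiv_apply_right]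
    exact this.symm

theorem exists_join (x : EuclideanSpace ℝ (Fin (m + k))) :
    ∃ (u : EuclideanSpace ℝ (Fin m)) (v : EuclideanSpace ℝ (Fin k)), x = join (u, v) :=
  ⟨WithLp.toLp 2 fun i => x (Fin.castAdd k i), WithLp.toLp 2 fun i => x (Fin.natAdd m i), by
    ext i
    refine Fin.addCases (fun i => ?_) (fun i => ?_) i <;> simp⟩

theorem join_sub (p q : EuclideanSpace ℝ (Fin m) × EuclideanSpace ℝ (Fin k)) :
    join p - join q = join (p - q) := by
  ext i
  refine Fin.addCases (fun i => ?_) (fun i => ?_) i <;> simp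

theorem smul_join (c : ℝ) (p : EuclideanSpace ℝ (Fin m) × EuclideanSpace ℝ (Fin k)) :
    c • join p = join (c • p) := by
  ext i
  refine Fin.addCases (fun i => ?_) (fun i => ?_) i <;> simp

theorem inner_join (p q : EuclideanSpace ℝ (Fin m) × EuclideanSpace ℝ (Fin k)) :
    inner ℝ (join p) (join q) = inner ℝ p.1 q.1 + inner ℝ p.2 q.2 := by
  simp [PiLp.inner_apply, Fin.sum_univ_add]

theorem norm_join_sq (p : EuclideanSpace ℝ (Fin m) × EuclideanSpace ℝ (Fin k)) :
    ‖join p‖ ^ 2 = ‖p.1‖ ^ 2 + ‖p.2‖ ^ 2 := by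
  simp only [← real_inner_self_eq_norm_sq, inner_join]

theorem norm_join_zero_left (v : EuclideanSpace ℝ (Fin k)) :
    ‖join ((0 : EuclideanSpace ℝ (Fin m)), v)‖ = ‖v‖ := by
  have h := norm_join_sq ((0 : EuclideanSpace ℝ (Fin m)), v)
  simp only [norm_zero, ne_eq, OfNat.ofNat_ne_zero, not_false_eq_true, zero_pow, zero_add] at h
  exact (sq_eq_sq₀ (norm_nonneg _) (norm_nonneg _)).1 h

theorem proj_join (u : EuclideanSpace ℝ (Fin m)) (v : EuclideanSpace ℝ (Fin k)) :
    proj m (join (u, v)) = join (u, 0) := by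
  ext i
  refine Fin.addCases (fun i => ?_) (fun i => ?_) i <;> simp [proj]

theorem perp_join (u : EuclideanSpace ℝ (Fin m)) (v : EuclideanSpace ℝ (Fin k)) :
    perp m (join (u, v)) = join (0, v) := by
  rw [perp, proj_join, join_sub]
  simp

theorem dir_perp_join (u : EuclideanSpace ℝ (Fin m)) (v : EuclideanSpace ℝ (Fin k)) :
    dir (perp m (join (u, v))) = join (0, dir v) := by
  rw [perp_join, dir, norm_join_zero_left, smul_join]
  simp [dir]

theorem infDist_join (u : EuclideanSpace ℝ (Fin m)) (v : EuclideanSpace ℝ (Fin k)) :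
    Metric.infDist (join (u, v)) (plane m (m + k)) = ‖v‖ := by
  rw [← dist_proj, dist_eq_norm, ← perp, perp_join, norm_join_zero_left]

theorem join_mem_plane (u : EuclideanSpace ℝ (Fin m)) (v : EuclideanSpace ℝ (Fin k)) :
    join (u, v) ∈ plane m (m + k) ↔ v = 0 := by
  constructor
  · intro h
    ext i
    simpa using h (Fin.natAdd m i) (by simp)
  · rintro rfl i hi
    revert hi
    refine Fin.addCases (fun i => ?_) (fun i => ?_) i
    · intro hi
      have : m ≤ i.val := hi
      omega
    · simp

/-- The open cube `(-R, R)ᵐ`. -/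
def cube (m : ℕ) (R : ℝ) : Set (EuclideanSpace ℝ (Fin m)) :=
  {u | ∀ i, u i ∈ Ioo (-R) R}

theorem join_mem_box {R : ℝ} (u : EuclideanSpace ℝ (Fin m)) (v : EuclideanSpace ℝ (Fin k)) :
    join (u, v) ∈ box m (m + k) R ↔ u ∈ cube m R ∧ v ∈ cube k R ∧ v ≠ 0 := by
  simp only [box, cube, mem_sdiff, mem_ofPred, join_mem_plane]
  constructor
  · rintro ⟨h, h0⟩
    exact ⟨fun i => by simpa using h (Fin.castAdd k i), fun i => by simpa using h (Fin.natAdd m i), h0⟩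
  · rintro ⟨h1, h2, h0⟩
    exact ⟨fun i => Fin.addCases (fun i => by simpa using h1 i) (fun i => by simpa using h2 i) i, h0⟩

theorem lastVec_add (m : ℕ) {k : ℕ} (hk : 0 < k) :
    lastVec (m + k) = join ((0 : EuclideanSpace ℝ (Fin m)), lastVec k) := by
  ext i
  refine Fin.addCases (fun i => ?_) (fun i => ?_) i
  · have : i.val + 1 ≠ m + k := by omega
    simp [lastVec, this]
  · simp [lastVec, add_assoc]

theorem pos_of_vector_ne_zero {v : EuclideanSpace ℝ (Fin k)} (hv : v ≠ 0) : 0 < k := by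
  rcases Nat.eq_zero_or_pos k with rfl | h
  · exact absurd (Subsingleton.elim v 0) hv
  · exact h

theorem norm_lastVec {k : ℕ} (hk : 0 < k) : ‖lastVec k‖ = 1 := by
  have : lastVec k = EuclideanSpace.single (⟨k - 1, by omega⟩ : Fin k) (1 : ℝ) := by
    ext i
    simp only [lastVec, PiLp.single_apply, Fin.ext_iff]
    congr 1
    simp; omega
  rw [this]; simp

theorem norm_dir {v : EuclideanSpace ℝ (Fin k)} (hv : v ≠ 0) : ‖dir v‖ = 1 := by
  simp [dir, norm_smul, hv]

theorem convex_cube (m : ℕ) (R : ℝ) : Convex ℝ (cube m R) := by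
  intro x hx y hy a b ha hb hab i
  exact convex_Ioo (-R) R (hx i) (hy i) ha hb hab

theorem isOpen_cube (m : ℕ) (R : ℝ) : IsOpen (cube m R) := by
  simp only [cube, ofPred_forall]
  exact isOpen_iInter_of_finite fun i => isOpen_Ioo.preimage (by fun_prop)

theorem norm_lt_of_mem_cube {R : ℝ} (hk : 0 < k)
    {v : EuclideanSpace ℝ (Fin k)} (hv : v ∈ cube k R) :
    ‖v‖ < Real.sqrt k * R := by
  have : Nonempty (Fin k) := ⟨⟨0, hk⟩⟩
  have hR : 0 < R := by have := hv ⟨0, hk⟩; linarith [this.1, this.2]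
  rw [EuclideanSpace.norm_eq, Real.sqrt_lt' (by positivity), mul_pow, Real.sq_sqrt (by positivity)]
  calc ∑ i, ‖v i‖ ^ 2 < ∑ i : Fin k, R ^ 2 := by
        refine Finset.sum_lt_sum_of_nonempty Finset.univ_nonempty fun i _ => ?_
        rw [Real.norm_eq_abs, sq_abs]
        nlinarith [(hv i).1, (hv i).2]
    _ = k * R ^ 2 := by simp

theorem mem_cube_of_norm_lt {R : ℝ} {v : EuclideanSpace ℝ (Fin k)} (hv : ‖v‖ < R) :
    v ∈ cube k R := fun i =>
  abs_lt.1 ((Real.norm_eq_abs _ ▸ PiLp.norm_apply_le v i).trans_lt hv)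

/-! ### Cones and their sections -/

/-- The radius of the section over `v` of the cone `C_θ(0; ω)`, where `ω ∈ ℝᵏ` is regarded as a
vector of `ℝᵐ × ℝᵏ`. It is `0` (an empty open ball) when the section is empty: if `v · ω ≤ 0` by
the case distinction, and otherwise because `Real.sqrt` vanishes on negative numbers. -/
noncomputable def radius (θ : ℝ) (ω v : EuclideanSpace ℝ (Fin k)) : ℝ :=
  if 0 < inner ℝ v ω then Real.sqrt ((inner ℝ v ω / Real.cos θ) ^ 2 - ‖v‖ ^ 2) else 0

theorem radius_nonneg (θ : ℝ) (ω v : EuclideanSpace ℝ (Fin k)) : 0 ≤ radius θ ω v := by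
  unfold radius
  split_ifs <;> positivity

theorem inner_pos_of_radius_pos {θ : ℝ} {ω v : EuclideanSpace ℝ (Fin k)} (h : 0 < radius θ ω v) :
    0 < inner ℝ v ω := by
  by_contra hn
  simp [radius, hn] at h

theorem radius_le {θ : ℝ} (hθ₀ : 0 < θ) (hθ : θ < Real.pi / 2) {ω : EuclideanSpace ℝ (Fin k)}
    (hω : ‖ω‖ = 1) (v : EuclideanSpace ℝ (Fin k)) : radius θ ω v ≤ Real.tan θ * ‖v‖ := by
  have hc : 0 < Real.cos θ := Real.cos_pos_of_mem_Ioo ⟨by linarith, hθ⟩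
  have ht : 0 < Real.tan θ := Real.tan_pos_of_pos_of_lt_pi_div_two hθ₀ hθ
  unfold radius
  split_ifs with h
  · rw [Real.sqrt_le_left (by positivity)]
    have h1 : inner ℝ v ω ≤ ‖v‖ := by simpa [hω] using real_inner_le_norm v ω
    have h2 : (inner ℝ v ω / Real.cos θ) ^ 2 ≤ (‖v‖ / Real.cos θ) ^ 2 := by gcongr
    have h3 : (‖v‖ / Real.cos θ) ^ 2 - ‖v‖ ^ 2 = (Real.tan θ * ‖v‖) ^ 2 := by
      rw [Real.tan_eq_sin_div_cos]
      field_simp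
      rw [Real.sin_sq]
    linarith
  · positivity

theorem measurable_radius (θ : ℝ) :
    Measurable fun p : EuclideanSpace ℝ (Fin k) × EuclideanSpace ℝ (Fin k) =>
      radius θ p.1 p.2 := by
  unfold radius
  exact Measurable.ite (measurableSet_lt measurable_const (by fun_prop)) (by fun_prop)
    measurable_const

/-- The section over `v` of a cone with vertex in `G` and axis orthogonal to `G` is a ball. -/
theorem join_mem_cone {θ : ℝ} (hc : 0 < Real.cos θ) (a u : EuclideanSpace ℝ (Fin m))
    (ω v : EuclideanSpace ℝ (Fin k)) :
    join (u, v) ∈ cone θ (join (a, 0)) (join (0, ω)) ↔ u ∈ ball a (radius θ ω v) := by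
  have hN : ‖join (u, v) - join (a, 0)‖ ^ 2 = dist u a ^ 2 + ‖v‖ ^ 2 := by
    rw [join_sub, norm_join_sq, dist_eq_norm]; simp
  have hI : inner ℝ (join (u, v) - join (a, 0)) (join (0, ω)) = inner ℝ v ω := by
    rw [join_sub, inner_join]; simp
  simp only [cone, mem_ofPred, hI, mem_ball]
  have hN0 := norm_nonneg (join (u, v) - join (a, 0))
  unfold radius
  split_ifs with h
  · rw [Real.lt_sqrt dist_nonneg, mul_comm, ← lt_div_iff₀ hc, ← sq_lt_sq₀ hN0 (by positivity), hN,
      lt_sub_iff_add_lt]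
  · simp only [not_lt.2 dist_nonneg, iff_false, not_lt]
    exact (not_lt.1 h).trans (by positivity)

theorem radius_smul (θ : ℝ) (ω v : EuclideanSpace ℝ (Fin k)) {r : ℝ} (hr : 0 < r) :
    radius θ ω (r • v) = r * radius θ ω v := by
  unfold radius
  simp only [inner_smul_left, norm_smul, Real.norm_eq_abs, abs_of_pos hr]
  simp only [conj_trivial, mul_pos_iff_of_pos_left hr, mul_ite, mul_zero]
  congr 1
  rw [← Real.sqrt_sq hr.le, ← Real.sqrt_mul (by positivity), Real.sqrt_sq hr.le]
  congr 1; ring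

/-- The part of the cone `C_θ(0; ω)` in `ℝᵐ × ℝᵏ` at distance in `(0, r)` from `ℝᵐ × {0}`. -/
def sector (m : ℕ) {k : ℕ} (θ : ℝ) (ω : EuclideanSpace ℝ (Fin k)) (r : ℝ) :
    Set (EuclideanSpace ℝ (Fin m) × EuclideanSpace ℝ (Fin k)) :=
  {p | ‖p.2‖ ∈ Ioo 0 r ∧ p.1 ∈ ball 0 (radius θ ω p.2)}

theorem measurableSet_sector (θ : ℝ) (ω : EuclideanSpace ℝ (Fin k)) (r : ℝ) :
    MeasurableSet (sector m θ ω r) := by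
  have hm : Measurable fun p : EuclideanSpace ℝ (Fin m) × EuclideanSpace ℝ (Fin k) =>
      radius θ ω p.2 :=
    (measurable_radius θ).comp (measurable_const.prodMk measurable_snd)
  refine MeasurableSet.inter ?_ ?_
  · exact measurableSet_Ioo.preimage (by fun_prop)
  · exact measurableSet_lt (f := fun p : EuclideanSpace ℝ (Fin m) × EuclideanSpace ℝ (Fin k) =>
      dist p.1 0) (by fun_prop) hm

theorem volume_sector_eq_mul (θ : ℝ) (ω : EuclideanSpace ℝ (Fin k)) {r : ℝ} (hr : 0 < r) :
    volume (sector m θ ω r) = ENNReal.ofReal (r ^ (m + k)) * volume (sector m θ ω 1) := by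
  have h : sector m θ ω r = r • sector m θ ω 1 := by
    ext p
    rw [mem_smul_set_iff_inv_smul_mem₀ hr.ne']
    have hr' : 0 < r⁻¹ := by positivity
    simp only [sector, mem_ofPred, Prod.smul_fst, Prod.smul_snd, mem_Ioo, mem_ball_zero_iff,
      norm_smul, Real.norm_eq_abs, abs_of_pos hr', radius_smul θ ω _ hr']
    rw [mul_lt_mul_iff_right₀ hr', mul_pos_iff_of_pos_left hr', inv_mul_lt_iff₀ hr, mul_one]
  have : (volume : Measure (EuclideanSpace ℝ (Fin m) × EuclideanSpace ℝ (Fin k))).IsAddHaarMeasure :=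
    Measure.prod.instIsAddHaarMeasure volume volume
  rw [h, Measure.addHaar_smul_of_nonneg _ hr.le]
  simp

/-- The reflection of `ℝᵏ` that exchanges `ω` and `ω'` carries one sector to the other, so the volume
does not depend on the direction of the axis. -/
theorem volume_sector_eq_of_norm_eq (θ : ℝ) {ω ω' : EuclideanSpace ℝ (Fin k)}
    (h : ‖ω‖ = ‖ω'‖) (r : ℝ) :
    volume (sector m θ ω r) = volume (sector m θ ω' r) := by
  set L := (ℝ ∙ (ω' - ω))ᗮ.reflection with hL
  have hLω : L ω' = ω := Submodule.reflection_sub h.symm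
  have hmp : MeasurePreserving
      (Prod.map id L : EuclideanSpace ℝ (Fin m) × EuclideanSpace ℝ (Fin k) → _) :=
    (MeasurePreserving.id volume).prod L.measurePreserving
  rw [← hmp.measure_preimage (measurableSet_sector θ ω r).nullMeasurableSet]
  congr 1
  ext p
  have hr : radius θ ω (L p.2) = radius θ ω' p.2 := by
    simp only [radius, ← hLω, LinearIsometryEquiv.inner_map_map, LinearIsometryEquiv.norm_map]
  simp [sector, hr]

theorem coneVol_eq {θ : ℝ} (hc : 0 < Real.cos θ) (hk : 0 < k) :
    coneVol m (m + k) θ = volume.real (sector m θ (lastVec k) 1) := by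
  unfold coneVol
  have hmeas : MeasurableSet (annulus (Ioo 0 1) (plane m (m + k)) ∩ cone θ 0 (lastVec (m + k))) := by
    refine MeasurableSet.inter ?_ ?_
    · exact measurableSet_Ioo.preimage (by fun_prop)
    · exact measurableSet_lt (by fun_prop) (by fun_prop)
  rw [measureReal_def, measureReal_def,
    ← measurePreserving_join.measure_preimage hmeas.nullMeasurableSet]
  congr 2
  ext ⟨u, v⟩
  have h0 : (0 : EuclideanSpace ℝ (Fin (m + k))) = join 0 := by
    simpa using join_sub (m := m) (k := k) 0 0
  rw [mem_preimage, mem_inter_iff, lastVec_add m hk, h0, ← Prod.mk_zero_zero, join_mem_cone hc]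
  simp [annulus, sector, infDist_join]

theorem volume_sector_lt_top {θ : ℝ} (hθ₀ : 0 < θ) (hθ : θ < Real.pi / 2)
    {ω : EuclideanSpace ℝ (Fin k)} (hω : ‖ω‖ = 1) (r : ℝ) : volume (sector m θ ω r) < ⊤ := by
  have ht : 0 < Real.tan θ := Real.tan_pos_of_pos_of_lt_pi_div_two hθ₀ hθ
  refine (Bornology.IsBounded.subset ((isBounded_ball (x := 0) (r := Real.tan θ * r)).prod
    (isBounded_ball (x := 0) (r := r))) ?_).measure_lt_top
  rintro ⟨u, v⟩ ⟨⟨h1, h2⟩, h3⟩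
  refine ⟨ball_subset_ball ?_ h3, by simpa using h2⟩
  exact (radius_le hθ₀ hθ hω v).trans (by gcongr)

theorem volume_sector_pos {θ : ℝ} (hθ₀ : 0 < θ) (hθ : θ < Real.pi / 2)
    {ω : EuclideanSpace ℝ (Fin k)} (hω : ‖ω‖ = 1) {r : ℝ} (hr : 0 < r) :
    0 < volume (sector m θ ω r) := by
  have hc : 0 < Real.cos θ := Real.cos_pos_of_mem_Ioo ⟨by linarith, hθ⟩
  have hc1 : Real.cos θ < 1 := by
    have := Real.cos_lt_cos_of_nonneg_of_le_pi le_rfl (by linarith) hθ₀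
    simpa using this
  have hs : {p : EuclideanSpace ℝ (Fin m) × EuclideanSpace ℝ (Fin k) |
      ‖p.2‖ ∈ Ioo 0 r ∧ Real.cos θ * ‖join (p.1, p.2) - join (0, 0)‖ < inner ℝ p.2 ω} =
      sector m θ ω r := by
    ext p
    simp only [sector, mem_ofPred, ← join_mem_cone hc, cone]
    rw [join_sub, inner_join]; simp
  have hcont : Continuous (join : EuclideanSpace ℝ (Fin m) × EuclideanSpace ℝ (Fin k) → _) := by
    unfold join
    refine (PiLp.continuous_toLp 2 _).comp (continuous_pi fun i => ?_)
    refine Fin.addCases (fun i => ?_) (fun i => ?_) i <;> simp <;> fun_prop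
  have ho : IsOpen (sector m θ ω r) := by
    rw [← hs]
    refine IsOpen.inter ?_ ?_
    · exact isOpen_Ioo.preimage (by fun_prop)
    · exact isOpen_lt (f := fun p : EuclideanSpace ℝ (Fin m) × EuclideanSpace ℝ (Fin k) =>
        Real.cos θ * ‖join (p.1, p.2) - join (0, 0)‖) (g := fun p => inner ℝ p.2 ω)
        (by fun_prop) (by fun_prop)
  refine ho.measure_pos _ ⟨(0, (r / 2) • ω), ?_⟩
  rw [← hs]
  simp only [mem_ofPred, join_sub, norm_smul, inner_smul_left, hω]
  simp only [sub_zero, norm_join_zero_left, norm_smul, hω, Prod.mk_sub_mk, real_inner_self_eq_norm_sq]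
  simp only [Real.norm_eq_abs, abs_of_pos (half_pos hr), mem_Ioo]
  refine ⟨⟨by linarith, by linarith⟩, ?_⟩
  simp
  nlinarith

/-- The homothety with centre `a` and ratio `t` maps `B ∩ ball c σ` into `B ∩ ball a ρ`: `B` is convex
and `ball c σ` lies in `ball a (2 * σ)`. -/
theorem ofReal_pow_mul_volume_le {B : Set (EuclideanSpace ℝ (Fin m))} (hB : Convex ℝ B)
    {a c : EuclideanSpace ℝ (Fin m)} (ha : a ∈ B) {σ t ρ : ℝ} (hac : dist a c < σ)
    (ht₀ : 0 < t) (ht₁ : t ≤ 1) (hρ : t * (2 * σ) ≤ ρ) :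
    ENNReal.ofReal (t ^ m) * volume (B ∩ ball c σ) ≤ volume (B ∩ ball a ρ) := by
  have h := Measure.addHaar_image_homothety (volume : Measure (EuclideanSpace ℝ (Fin m))) a t
    (B ∩ ball c σ)
  rw [finrank_euclideanSpace_fin, abs_of_pos (by positivity)] at h
  rw [← h]
  refine measure_mono ?_
  rintro _ ⟨u, ⟨huB, huc⟩, rfl⟩
  refine ⟨?_, ?_⟩
  · rw [AffineMap.homothety_eq_lineMap]
    exact hB.lineMap_mem ha huB ⟨ht₀.le, ht₁⟩
  · rw [mem_ball] at huc ⊢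
    rw [dist_homothety_center, Real.norm_eq_abs, abs_of_pos ht₀]
    refine lt_of_lt_of_le ?_ hρ
    gcongr
    calc dist a u ≤ dist a c + dist u c := dist_triangle_right _ _ _
      _ < 2 * σ := by linarith

/-! ### Volume of the sets `Ψ(x)` -/

/-- When `b * ‖z‖ ≤ R`, the conditions of `E` on the last `k` coordinates follow from
`0 < d_G(y) < b * ‖z‖`. -/
theorem join_preimage_Psi {θ : ℝ} (hc : 0 < Real.cos θ) {R b : ℝ} (a : EuclideanSpace ℝ (Fin m))
    {z : EuclideanSpace ℝ (Fin k)} (hb : b * ‖z‖ ≤ R) :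
    join ⁻¹' Psi m (m + k) R θ b (join (a, z)) =
      {p | p.1 ∈ cube m R ∧ ‖p.2‖ ∈ Ioo 0 (b * ‖z‖) ∧ p.1 ∈ ball a (radius θ (dir z) p.2)} := by
  ext ⟨u, v⟩
  simp only [Psi, mem_preimage, mem_inter_iff, annulus, mem_ofPred, infDist_join, join_mem_box,
    dir_perp_join, proj_join, join_mem_cone hc]
  constructor
  · rintro ⟨⟨⟨h1, -, -⟩, h2⟩, h3⟩
    exact ⟨h1, h2, h3⟩
  · rintro ⟨h1, h2, h3⟩
    exact ⟨⟨⟨h1, mem_cube_of_norm_lt (h2.2.trans_le hb), norm_pos_iff.1 h2.1⟩, h2⟩, h3⟩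

theorem measurableSet_box (m n : ℕ) (R : ℝ) : MeasurableSet (box m n R) := by
  refine MeasurableSet.diff (isOpen_cube n R).measurableSet (IsClosed.measurableSet ?_)
  simp only [plane, coordPlane, ofPred_forall]
  exact isClosed_iInter fun i => isClosed_iInter fun _ => isClosed_eq (by fun_prop) continuous_const

theorem measurableSet_graph_Psi (m n : ℕ) (R θ b : ℝ) :
    MeasurableSet {q : EuclideanSpace ℝ (Fin n) × EuclideanSpace ℝ (Fin n) |
      q.2 ∈ Psi m n R θ b q.1} := by
  have hp : Measurable (proj m : EuclideanSpace ℝ (Fin n) → _) := by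
    refine (WithLp.measurable_toLp _ _).comp (measurable_pi_lambda _ fun i => ?_)
    split_ifs <;> fun_prop
  have hd : Measurable fun x : EuclideanSpace ℝ (Fin n) => dir (perp m x) := by
    unfold dir perp
    fun_prop
  have hi : Measurable fun x : EuclideanSpace ℝ (Fin n) => infDist x (plane m n) :=
    (continuous_infDist_pt _).measurable
  have hsub : Measurable fun q : EuclideanSpace ℝ (Fin n) × EuclideanSpace ℝ (Fin n) =>
      q.2 - proj m q.1 := measurable_snd.sub (hp.comp measurable_fst)
  have h₁ : MeasurableSet {q : EuclideanSpace ℝ (Fin n) × EuclideanSpace ℝ (Fin n) |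
      q.2 ∈ box m n R} := measurable_snd (measurableSet_box m n R)
  have h₂ : MeasurableSet {q : EuclideanSpace ℝ (Fin n) × EuclideanSpace ℝ (Fin n) |
      0 < infDist q.2 (plane m n)} := measurableSet_lt measurable_const (hi.comp measurable_snd)
  have h₃ : MeasurableSet {q : EuclideanSpace ℝ (Fin n) × EuclideanSpace ℝ (Fin n) |
      infDist q.2 (plane m n) < b * infDist q.1 (plane m n)} :=
    measurableSet_lt (hi.comp measurable_snd) ((hi.comp measurable_fst).const_mul b)
  have h₄ : MeasurableSet {q : EuclideanSpace ℝ (Fin n) × EuclideanSpace ℝ (Fin n) |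
      Real.cos θ * ‖q.2 - proj m q.1‖ < inner ℝ (q.2 - proj m q.1) (dir (perp m q.1))} :=
    measurableSet_lt (hsub.norm.const_mul _) (hsub.inner (hd.comp measurable_fst))
  exact (h₁.inter (h₂.inter h₃)).inter h₄

theorem measurableSet_Psi (m n : ℕ) (R θ b : ℝ) (x : EuclideanSpace ℝ (Fin n)) :
    MeasurableSet (Psi m n R θ b x) :=
  measurable_prodMk_left (measurableSet_graph_Psi m n R θ b)

theorem measurableSet_PsiInv (m n : ℕ) (R θ b : ℝ) (y : EuclideanSpace ℝ (Fin n)) :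
    MeasurableSet (PsiInv m n R θ b y) :=
  (measurableSet_box m n R).inter (measurable_prodMk_right (measurableSet_graph_Psi m n R θ b))

theorem measurable_volume_Psi (m n : ℕ) (R θ b : ℝ) :
    Measurable fun x : EuclideanSpace ℝ (Fin n) => volume (Psi m n R θ b x) :=
  measurable_measure_prodMk_left (measurableSet_graph_Psi m n R θ b)

theorem volume_Psi_lt_top (m n : ℕ) (R θ b : ℝ) (x : EuclideanSpace ℝ (Fin n)) :
    volume (Psi m n R θ b x) < ⊤ := by
  rcases Nat.eq_zero_or_pos n with rfl | hn
  · exact (Set.toFinite _).isBounded.measure_lt_top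
  · refine (isBounded_ball (x := 0) (r := Real.sqrt n * R)).subset ?_ |>.measure_lt_top
    intro y hy
    simpa using norm_lt_of_mem_cube hn hy.1.1.1

theorem ballVol_pos (m : ℕ) : 0 < ballVol m :=
  ENNReal.toReal_pos (measure_ball_pos _ _ one_pos).ne' measure_ball_lt_top.ne

theorem coneVol_pos {θ : ℝ} (hθ₀ : 0 < θ) (hθ : θ < Real.pi / 2) (hk : 0 < k) :
    0 < coneVol m (m + k) θ := by
  rw [coneVol_eq (Real.cos_pos_of_mem_Ioo ⟨by linarith, hθ⟩) hk]
  exact ENNReal.toReal_pos (volume_sector_pos hθ₀ hθ (norm_lastVec hk) one_pos).ne'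
    (volume_sector_lt_top hθ₀ hθ (norm_lastVec hk) 1).ne

/-- The section of `Ψ(x)` over `v` is `cube m R ∩ ball a ρ`, where `ρ = radius θ (dir z) v`. It
contains a copy of `cube m R ∩ ball c σ` scaled by a factor proportional to `ρ`; its volume is
thus at least proportional to that of the section `ball 0 ρ` of the full cone. -/
theorem le_volume_Psi {θ : ℝ} (hθ₀ : 0 < θ) (hθ : θ < Real.pi / 2) {R b : ℝ} (hb₀ : 0 < b)
    {a : EuclideanSpace ℝ (Fin m)} (ha : a ∈ cube m R) {z : EuclideanSpace ℝ (Fin k)} (hz : z ≠ 0)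
    (hb : b * ‖z‖ ≤ R) {c : EuclideanSpace ℝ (Fin m)} {s σ : ℝ} (hs : 0 < s) (hac : dist a c < σ)
    (hσ : σ ≤ Real.tan θ * s) :
    ENNReal.ofReal (min 1 (b * ‖z‖ / (2 * s)) ^ m * (b * ‖z‖) ^ k * coneVol m (m + k) θ /
        (ballVol m * Real.tan θ ^ m)) * volume (cube m R ∩ ball c σ) ≤
      volume (Psi m (m + k) R θ b (join (a, z))) := by
  have hcos : 0 < Real.cos θ := Real.cos_pos_of_mem_Ioo ⟨by linarith, hθ⟩
  have hT : 0 < Real.tan θ := Real.tan_pos_of_pos_of_lt_pi_div_two hθ₀ hθ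
  have hk : 0 < k := pos_of_vector_ne_zero hz
  have hr : 0 < ‖z‖ := norm_pos_iff.2 hz
  set τ := b * ‖z‖ with hτ_def
  set T := Real.tan θ with hT_def
  have hτ : 0 < τ := by positivity
  set q := min 1 (τ / (2 * s)) with hq_def
  have hq : 0 < q := lt_min one_pos (by positivity)
  set ω := dir z
  have hω : ‖ω‖ = 1 := norm_dir hz
  set Q := volume (cube m R ∩ ball c σ)
  have hκ : volume (ball (0 : EuclideanSpace ℝ (Fin m)) 1) = ENNReal.ofReal (ballVol m) :=
    (ofReal_measureReal measure_ball_lt_top.ne).symm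
  have hC : volume (sector m θ ω τ) = ENNReal.ofReal (τ ^ (m + k) * coneVol m (m + k) θ) := by
    rw [volume_sector_eq_mul θ ω hτ, ENNReal.ofReal_mul (by positivity), coneVol_eq hcos hk,
      volume_sector_eq_of_norm_eq θ (hω.trans (norm_lastVec hk).symm),
      ofReal_measureReal (volume_sector_lt_top hθ₀ hθ (norm_lastVec hk) 1).ne]
  have hκ₀ := ballVol_pos m
  -- The homothety ratio `q * ρ / (T * τ)` is at most `1` because `ρ ≤ T * τ`, and maps radius
  -- `2 * σ ≤ 2 * T * s` to at most `ρ` because `q ≤ τ / (2 * s)`.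
  have hpoint : ∀ v : EuclideanSpace ℝ (Fin k), ‖v‖ < τ →
      ENNReal.ofReal ((q / (T * τ)) ^ m / ballVol m) * Q * volume (ball 0 (radius θ ω v) :
        Set (EuclideanSpace ℝ (Fin m))) ≤ volume (cube m R ∩ ball a (radius θ ω v)) := by
    intro v hv
    rcases (radius_nonneg θ ω v).eq_or_lt with h0 | hpos
    · simp [← h0]
    · have hle := radius_le hθ₀ hθ hω v
      have hle' : radius θ ω v ≤ T * τ := hle.trans (by gcongr)
      refine le_trans (le_of_eq ?_) (ofReal_pow_mul_volume_le (convex_cube m R) ha hac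
        (t := q * radius θ ω v / (T * τ)) (by positivity) ?_ ?_)
      · rw [Measure.addHaar_ball_of_pos _ _ hpos, finrank_euclideanSpace_fin, hκ,
          ← ENNReal.ofReal_mul (by positivity), mul_right_comm,
          ← ENNReal.ofReal_mul (by positivity)]
        congr 2
        rw [mul_div_right_comm, mul_pow]
        field_simp
      · rw [div_le_one (by positivity)]
        calc q * radius θ ω v ≤ 1 * (T * τ) := by
              gcongr; exact min_le_left _ _
          _ = _ := one_mul _
      · have hq2 : q ≤ τ / (2 * s) := min_le_right _ _
        have hσ₀ : 0 < σ := dist_nonneg.trans_lt hac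
        calc q * radius θ ω v / (T * τ) * (2 * σ)
            ≤ τ / (2 * s) * radius θ ω v / (T * τ) * (2 * (T * s)) := by gcongr
          _ = radius θ ω v := by field_simp
  have hΨ := measurableSet_Psi m (m + k) R θ b (join (a, z))
  rw [← measurePreserving_join.measure_preimage hΨ.nullMeasurableSet, Measure.volume_eq_prod,
    Measure.prod_apply_symm (measurePreserving_join.measurable hΨ), join_preimage_Psi hcos a hb]
  calc _ = ENNReal.ofReal ((q / (T * τ)) ^ m / ballVol m) * Q * volume (sector m θ ω τ) := by
        rw [hC, mul_right_comm (ENNReal.ofReal _) Q, ← ENNReal.ofReal_mul (by positivity)]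
        congr 2
        rw [div_pow, mul_pow T τ, pow_add]
        field_simp
    _ = ∫⁻ v, ENNReal.ofReal ((q / (T * τ)) ^ m / ballVol m) * Q *
          volume ((fun u => (u, v)) ⁻¹' sector m θ ω τ) := by
        rw [lintegral_const_mul _
          (measurable_measure_prodMk_right (measurableSet_sector θ ω τ)), Measure.volume_eq_prod,
          Measure.prod_apply_symm (measurableSet_sector θ ω τ)]
    _ ≤ _ := by
        refine lintegral_mono fun v => ?_
        by_cases hv : ‖v‖ ∈ Ioo 0 τ
        · refine le_trans (le_of_eq ?_) ((hpoint v hv.2).trans (measure_mono ?_))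
          · congr 2
            ext u
            simp only [sector, mem_preimage, mem_ofPred]
            exact and_iff_right hv
          · rintro u ⟨h1, h2⟩
            exact ⟨h1, hv, h2⟩
        · have : (fun u => (u, v)) ⁻¹' sector m θ ω τ = ∅ := by
            exact eq_empty_of_forall_notMem fun u hu => hv hu.1
          rw [this]; simp

theorem volume_Psi_pos {θ : ℝ} (hθ₀ : 0 < θ) (hθ : θ < Real.pi / 2) {R b : ℝ} (hb₀ : 0 < b)
    {a : EuclideanSpace ℝ (Fin m)} (ha : a ∈ cube m R) {z : EuclideanSpace ℝ (Fin k)} (hz : z ≠ 0)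
    (hb : b * ‖z‖ ≤ R) : 0 < volume (Psi m (m + k) R θ b (join (a, z))) := by
  have hT : 0 < Real.tan θ := Real.tan_pos_of_pos_of_lt_pi_div_two hθ₀ hθ
  have hk : 0 < k := pos_of_vector_ne_zero hz
  -- Any admissible `c`, `s`, `σ` will do; here `c = a`, `s = 1` and `σ = tan θ`.
  refine lt_of_lt_of_le ?_ (le_volume_Psi hθ₀ hθ hb₀ ha hz hb one_pos (c := a)
    (σ := Real.tan θ) (by simpa using hT) (by simp))
  have hr : 0 < ‖z‖ := norm_pos_iff.2 hz
  have := coneVol_pos (m := m) hθ₀ hθ hk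
  have := ballVol_pos m
  refine ENNReal.mul_pos (ENNReal.ofReal_pos.2 (by positivity)).ne' ?_
  exact (((isOpen_cube m R).inter isOpen_ball).measure_pos _ ⟨a, ha, mem_ball_self hT⟩).ne'

/-! ### Integration over `Ψ⁻¹(y)` -/

theorem measurableEmbedding_join :
    MeasurableEmbedding (join : EuclideanSpace ℝ (Fin m) × EuclideanSpace ℝ (Fin k) → _) := by
  refine Measurable.measurableEmbedding measurePreserving_join.measurable fun p q h => ?_
  have h0 : join (p - q) = 0 := by rw [← join_sub, h, sub_self]
  have h1 := norm_join_sq (p - q)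
  rw [h0, norm_zero] at h1
  have h2 : ‖(p - q).1‖ = 0 := by nlinarith [norm_nonneg (p - q).1, norm_nonneg (p - q).2]
  have h3 : ‖(p - q).2‖ = 0 := by nlinarith [norm_nonneg (p - q).1, norm_nonneg (p - q).2]
  exact Prod.ext (sub_eq_zero.1 (norm_eq_zero.1 h2)) (sub_eq_zero.1 (norm_eq_zero.1 h3))

/-- Only an inequality, which spares the measurability of `f`. -/
theorem lintegral_le_lintegral_join (f : EuclideanSpace ℝ (Fin (m + k)) → ℝ≥0∞) :
    ∫⁻ x, f x ≤
      ∫⁻ z : EuclideanSpace ℝ (Fin k), ∫⁻ a : EuclideanSpace ℝ (Fin m), f (join (a, z)) := by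
  rw [← measurePreserving_join.lintegral_comp_emb measurableEmbedding_join f,
    Measure.volume_eq_prod, ← (Measure.measurePreserving_swap).lintegral_comp_emb
      MeasurableEquiv.prodComm.measurableEmbedding (fun p => f (join p))]
  exact lintegral_prod_le _

/-- The half-space and its reflection in the origin are disjoint and carry the same integral. -/
theorem two_mul_setLIntegral_halfSpace_le {w : EuclideanSpace ℝ (Fin k)} (f : ℝ → ℝ≥0∞) :
    2 * ∫⁻ z in {z | 0 < inner ℝ w z}, f ‖z‖ ≤ ∫⁻ z : EuclideanSpace ℝ (Fin k), f ‖z‖ := by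
  have hm : ∀ v : EuclideanSpace ℝ (Fin k), MeasurableSet {z | 0 < inner ℝ v z} := fun v =>
    measurableSet_lt measurable_const (by fun_prop)
  have h := (Measure.measurePreserving_neg
    (volume : Measure (EuclideanSpace ℝ (Fin k)))).setLIntegral_comp_preimage_emb
    (MeasurableEquiv.neg _).measurableEmbedding (fun z => f ‖z‖) {z | 0 < inner ℝ w z}
  have hd : Disjoint {z | 0 < inner ℝ w z} (Neg.neg ⁻¹' {z | 0 < inner ℝ w z}) := by
    refine Set.disjoint_left.2 fun z h1 h2 => ?_
    simp only [mem_preimage, mem_ofPred, inner_neg_right] at h1 h2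
    linarith
  rw [two_mul]
  nth_rw 2 [← h]
  simp only [norm_neg]
  rw [← lintegral_union (measurable_neg (hm w)) hd]
  exact setLIntegral_le_lintegral _ _

theorem sphereArea_eq (k : ℕ) : sphereArea k = k * ballVol k := by
  simp [sphereArea, ballVol]

/-- Polar coordinates: `∫_ρ^∞ r ^ (k - 1) * r ^ (-(p + k)) dr = ρ ^ (-p) / p`, and the half-space
halves the area of the sphere. -/
theorem setLIntegral_norm_rpow_le (hk : 0 < k) (w : EuclideanSpace ℝ (Fin k)) {ρ p : ℝ}
    (hρ : 0 < ρ) (hp : 0 < p) :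
    ∫⁻ z in {z | 0 < inner ℝ w z},
        (Ioi ρ).indicator (fun r => ENNReal.ofReal (r ^ (-(p + k)))) ‖z‖ ≤
      ENNReal.ofReal (sphereArea k / 2 * (ρ ^ (-p) / p)) := by
  have : Nonempty (Fin k) := ⟨⟨0, hk⟩⟩
  have key : ∀ y : ℝ, y ∈ Ioi (0 : ℝ) → y ^ (k - 1) • (Ioi ρ).indicator (fun r => r ^ (-(p + k))) y =
      (Ioi ρ).indicator (fun r => r ^ (-p - 1)) y := by
    intro y hy
    have hy : 0 < y := hy
    by_cases hyρ : y ∈ Ioi ρ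
    · simp only [indicator_of_mem hyρ, smul_eq_mul]
      rw [← Real.rpow_natCast, ← Real.rpow_add hy, Nat.cast_sub hk]
      congr 1; push_cast; ring
    · simp [indicator_of_notMem hyρ]
  have hint : IntegrableOn ((Ioi ρ).indicator fun r : ℝ => r ^ (-p - 1)) (Ioi 0) :=
    ((integrable_indicator_iff measurableSet_Ioi).2
      (integrableOn_Ioi_rpow_of_lt (by linarith) hρ)).integrableOn
  have hi : Integrable fun z : EuclideanSpace ℝ (Fin k) =>
      (Ioi ρ).indicator (fun r => r ^ (-(p + k))) ‖z‖ := by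
    rw [integrable_fun_norm_addHaar, finrank_euclideanSpace_fin]
    exact hint.congr_fun (fun y hy => (key y hy).symm) measurableSet_Ioi
  have hI : ∫ z : EuclideanSpace ℝ (Fin k), (Ioi ρ).indicator (fun r => r ^ (-(p + k))) ‖z‖ =
      sphereArea k * (ρ ^ (-p) / p) := by
    rw [integral_fun_norm_addHaar, finrank_euclideanSpace_fin,
      setIntegral_congr_fun measurableSet_Ioi key, setIntegral_indicator measurableSet_Ioi,
      Ioi_inter_Ioi, sup_eq_right.2 hρ.le, integral_Ioi_rpow_of_lt (by linarith) hρ, sphereArea_eq]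
    simp only [nsmul_eq_mul, smul_eq_mul, ballVol, mul_assoc]
    rw [show -p - 1 + 1 = -p by ring, neg_div_neg_eq]
  have h0 : ∀ z : EuclideanSpace ℝ (Fin k),
      (Ioi ρ).indicator (fun r => ENNReal.ofReal (r ^ (-(p + k)))) ‖z‖ =
        ENNReal.ofReal ((Ioi ρ).indicator (fun r => r ^ (-(p + k))) ‖z‖) := by
    intro z
    by_cases hz : ‖z‖ ∈ Ioi ρ
    · simp only [indicator_of_mem hz]
    · simp [indicator_of_notMem hz]
  have h2 := two_mul_setLIntegral_halfSpace_le (w := w)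
    ((Ioi ρ).indicator (fun r => ENNReal.ofReal (r ^ (-(p + k)))))
  have h3 : ∫⁻ z : EuclideanSpace ℝ (Fin k),
      (Ioi ρ).indicator (fun r => ENNReal.ofReal (r ^ (-(p + k)))) ‖z‖ =
      ENNReal.ofReal (sphereArea k * (ρ ^ (-p) / p)) := by
    rw [lintegral_congr h0, ← hI]
    exact (ofReal_integral_eq_lintegral_ofReal hi (.of_forall fun z =>
      indicator_nonneg (fun r hr => Real.rpow_nonneg (hρ.trans hr).le _) _)).symm
  rw [h3] at h2
  rw [div_mul_eq_mul_div, ENNReal.ofReal_div_of_pos two_pos,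
    ENNReal.le_div_iff_mul_le (by simp) (by simp), mul_comm]
  simpa using h2

/-- The fibre of `Ψ⁻¹(y)` over `z` is contained in `S = cube m R ∩ ball u (radius θ (dir z) w)`,
and `le_volume_Psi` bounds the integrand there by a function of `‖z‖` times `(volume S)⁻¹`; hence
the integral over the fibre is at most this function of `‖z‖`. -/
theorem setLIntegral_PsiInv_le {θ : ℝ} (hθ₀ : 0 < θ) (hθ : θ < Real.pi / 2) {R b : ℝ} (hb₀ : 0 < b)
    (hb : ∀ z ∈ cube k R, b * ‖z‖ ≤ R) {β K : ℝ}
    {γ : EuclideanSpace ℝ (Fin (m + k)) → ℝ}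
    (hγ : ∀ x ∈ box m (m + k) R, infDist x (plane m (m + k)) ^ β * γ x ≤ K)
    (u : EuclideanSpace ℝ (Fin m)) {w : EuclideanSpace ℝ (Fin k)} (hw : w ≠ 0) :
    ∫⁻ x in PsiInv m (m + k) R θ b (join (u, w)),
        ENNReal.ofReal (γ x / volume.real (Psi m (m + k) R θ b x)) ≤
      ∫⁻ z in {z | 0 < inner ℝ w z}, (Ioi (‖w‖ / b)).indicator (fun r => ENNReal.ofReal
        (K * r ^ (-β) / (min 1 (b * r / (2 * ‖w‖)) ^ m * (b * r) ^ k * coneVol m (m + k) θ /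
        (ballVol m * Real.tan θ ^ m)))) ‖z‖ := by
  have hcos : 0 < Real.cos θ := Real.cos_pos_of_mem_Ioo ⟨by linarith, hθ⟩
  have hT : 0 < Real.tan θ := Real.tan_pos_of_pos_of_lt_pi_div_two hθ₀ hθ
  have hk : 0 < k := pos_of_vector_ne_zero hw
  have hs : 0 < ‖w‖ := norm_pos_iff.2 hw
  have hc := coneVol_pos (m := m) hθ₀ hθ hk
  have hκ := ballVol_pos m
  rw [← lintegral_indicator (measurableSet_PsiInv ..)]
  refine (lintegral_le_lintegral_join _).trans ?_
  rw [← lintegral_indicator (measurableSet_lt measurable_const (by fun_prop))]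
  refine lintegral_mono fun z => ?_
  set g : ℝ → ℝ := fun r => min 1 (b * r / (2 * ‖w‖)) ^ m * (b * r) ^ k * coneVol m (m + k) θ /
        (ballVol m * Real.tan θ ^ m) with hg
  set S := cube m R ∩ ball u (radius θ (dir z) w) with hS
  have hmem : ∀ a, join (a, z) ∈ PsiInv m (m + k) R θ b (join (u, w)) →
      a ∈ S ∧ z ∈ cube k R ∧ 0 < inner ℝ w z ∧ ‖w‖ / b < ‖z‖ := by
    rintro a ⟨h1, h2⟩
    rw [join_mem_box] at h1
    have h3 : (u, w) ∈ join ⁻¹' Psi m (m + k) R θ b (join (a, z)) := h2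
    rw [join_preimage_Psi hcos a (hb z h1.2.1)] at h3
    obtain ⟨-, h4, h5⟩ := h3
    have h5 : u ∈ ball a (radius θ (dir z) w) := h5
    have h4 : ‖w‖ ∈ Ioo 0 (b * ‖z‖) := h4
    refine ⟨⟨h1.1, mem_ball_comm.1 h5⟩, h1.2.1, ?_, ?_⟩
    · have := inner_pos_of_radius_pos (pos_of_mem_ball h5)
      rw [dir, inner_smul_right] at this
      exact pos_of_mul_pos_right this (by positivity)
    · rw [div_lt_iff₀ hb₀, mul_comm]; exact h4.2
  by_cases hz : 0 < inner ℝ w z ∧ ‖w‖ / b < ‖z‖ ∧ z ∈ cube k R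
  · obtain ⟨hz1, hz2, hz3⟩ := hz
    have hr : 0 < ‖z‖ := (by positivity : 0 < ‖w‖ / b).trans hz2
    have hz0 : z ≠ 0 := norm_pos_iff.1 hr
    have hgr : 0 < g ‖z‖ := by
      have : 0 < min 1 (b * ‖z‖ / (2 * ‖w‖)) := lt_min one_pos (by positivity)
      simp only [hg]; positivity
    rw [indicator_of_mem (show z ∈ {z | 0 < inner ℝ w z} from hz1), indicator_of_mem (mem_Ioi.2 hz2)]
    have hpt : ∀ a, (PsiInv m (m + k) R θ b (join (u, w))).indicator (fun x =>
        ENNReal.ofReal (γ x / volume.real (Psi m (m + k) R θ b x))) (join (a, z)) ≤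
        S.indicator (fun _ => ENNReal.ofReal (K * ‖z‖ ^ (-β) / g ‖z‖) * (volume S)⁻¹) a := by
      intro a
      by_cases ha : join (a, z) ∈ PsiInv m (m + k) R θ b (join (u, w))
      · have haS := (hmem a ha).1
        have haB : join (a, z) ∈ box m (m + k) R := ha.1
        rw [indicator_of_mem ha, indicator_of_mem haS]
        have hV := le_volume_Psi hθ₀ hθ hb₀ haS.1 hz0 (hb z hz3) hs (mem_ball.1 haS.2)
          (radius_le hθ₀ hθ (norm_dir hz0) w)
        have hVpos := volume_Psi_pos hθ₀ hθ hb₀ haS.1 hz0 (hb z hz3)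
        have hVtop := volume_Psi_lt_top m (m + k) R θ b (join (a, z))
        have hγa : γ (join (a, z)) ≤ K * ‖z‖ ^ (-β) := by
          have := hγ _ haB
          rw [infDist_join] at this
          rw [Real.rpow_neg hr.le, ← div_eq_mul_inv, le_div_iff₀ (by positivity), mul_comm]
          exact this
        have hVreal : 0 < volume.real (Psi m (m + k) R θ b (join (a, z))) :=
          ENNReal.toReal_pos hVpos.ne' hVtop.ne
        rw [ENNReal.ofReal_div_of_pos hVreal,
          ofReal_measureReal hVtop.ne, ENNReal.ofReal_div_of_pos hgr, div_eq_mul_inv,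
          div_eq_mul_inv, mul_assoc,
          ← ENNReal.mul_inv (Or.inl (ENNReal.ofReal_pos.2 hgr).ne') (Or.inl ENNReal.ofReal_ne_top)]
        gcongr
      · rw [indicator_of_notMem ha]
        exact zero_le
    refine (lintegral_mono hpt).trans ?_
    rw [lintegral_indicator_const (((isOpen_cube m R).inter isOpen_ball).measurableSet), mul_assoc]
    exact mul_le_of_le_one_right zero_le (ENNReal.inv_mul_le_one _)
  · have : ∀ a, (PsiInv m (m + k) R θ b (join (u, w))).indicator (fun x =>
        ENNReal.ofReal (γ x / volume.real (Psi m (m + k) R θ b x))) (join (a, z)) = 0 := by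
      intro a
      refine indicator_of_notMem (fun ha => hz ?_) _
      obtain ⟨-, h1, h2, h3⟩ := hmem a ha
      exact ⟨h2, h3, h1⟩
    simp [this]

/-! ### The constant -/

theorem inv_min_pow_le (m : ℕ) {t : ℝ} (ht : 0 < t) : (min 1 t ^ m)⁻¹ ≤ 1 + (t ^ m)⁻¹ := by
  rcases le_total 1 t with h | h
  · rw [min_eq_left h]
    have : 0 < (t ^ m)⁻¹ := by positivity
    simp [this.le]
  · rw [min_eq_right h]
    linarith

/-- The numerical inequality behind the constant `K₄ / n`; it rests on `m + k ≤ 2ᵐ k`. -/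
theorem one_div_add_two_pow_div_le (m : ℕ) {k : ℕ} (hk : 0 < k) {β : ℝ} (hβ : k < β) :
    1 / β + 2 ^ m / (β + m) ≤ 2 * 2 ^ m / ((m + k : ℕ) : ℝ) := by
  have hk' : (1 : ℝ) ≤ k := by exact_mod_cast hk
  have hm : (0 : ℝ) ≤ m := m.cast_nonneg
  have h2 : (m : ℝ) + 1 ≤ 2 ^ m := by exact_mod_cast Nat.lt_two_pow_self (n := m)
  have h3 : (m + k : ℝ) ≤ 2 ^ m * k := by nlinarith
  have h4 : 1 / β ≤ 2 ^ m / ((m + k : ℕ) : ℝ) := by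
    push_cast
    rw [div_le_div_iff₀ (by linarith) (by linarith)]
    nlinarith [pow_pos (two_pos : (0 : ℝ) < 2) m]
  have h5 : 2 ^ m / (β + m) ≤ 2 ^ m / ((m + k : ℕ) : ℝ) := by
    push_cast
    gcongr 2 ^ m / ?_
    linarith
  calc _ ≤ _ := add_le_add h4 h5
    _ = _ := by ring

theorem setLIntegral_PsiInv_le_ofReal {θ : ℝ} (hθ₀ : 0 < θ) (hθ : θ < Real.pi / 2) {R b : ℝ}
    (hb₀ : 0 < b) (hb : ∀ z ∈ cube k R, b * ‖z‖ ≤ R) {β K : ℝ} (hK : 0 ≤ K) (hβ : k < β)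
    {γ : EuclideanSpace ℝ (Fin (m + k)) → ℝ}
    (hγ : ∀ x ∈ box m (m + k) R, infDist x (plane m (m + k)) ^ β * γ x ≤ K)
    (u : EuclideanSpace ℝ (Fin m)) {w : EuclideanSpace ℝ (Fin k)} (hw : w ≠ 0) :
    ∫⁻ x in PsiInv m (m + k) R θ b (join (u, w)),
        ENNReal.ofReal (γ x / volume.real (Psi m (m + k) R θ b x)) ≤
      ENNReal.ofReal (K * K4 m (m + k) θ / (m + k : ℕ) * b ^ (β - k) * ‖w‖ ^ (-β)) := by
  have hT : 0 < Real.tan θ := Real.tan_pos_of_pos_of_lt_pi_div_two hθ₀ hθ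
  have hk : 0 < k := pos_of_vector_ne_zero hw
  have hβ₀ : 0 < β := k.cast_nonneg.trans_lt hβ
  have hs : 0 < ‖w‖ := norm_pos_iff.2 hw
  have hc := coneVol_pos (m := m) hθ₀ hθ hk
  have hκ := ballVol_pos m
  have hσ : 0 < sphereArea k := by
    rw [sphereArea_eq]; exact mul_pos (by exact_mod_cast hk) (ballVol_pos k)
  set s := ‖w‖
  set c := coneVol m (m + k) θ with hc_def
  set T := Real.tan θ with hT_def
  set κ := ballVol m with hκ_def
  have hρ : 0 < s / b := by positivity
  set ρ := s / b with hρ_def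
  set A := K * κ * T ^ m / (c * b ^ k) with hA
  have hA₀ : 0 ≤ A := by positivity
  refine (setLIntegral_PsiInv_le hθ₀ hθ hb₀ hb hγ u hw).trans ?_
  have hpt : ∀ r : ℝ, (Ioi ρ).indicator (fun r => ENNReal.ofReal
      (K * r ^ (-β) / (min 1 (b * r / (2 * s)) ^ m * (b * r) ^ k * c / (κ * T ^ m)))) r ≤
      ENNReal.ofReal A * (Ioi ρ).indicator (fun r => ENNReal.ofReal (r ^ (-(β + k)))) r +
      ENNReal.ofReal (A * (2 * ρ) ^ m) *
        (Ioi ρ).indicator (fun r => ENNReal.ofReal (r ^ (-(β + m + k)))) r := by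
    intro r
    by_cases hr : r ∈ Ioi ρ
    · simp only [indicator_of_mem hr]
      have hr0 : 0 < r := hρ.trans hr
      rw [← ENNReal.ofReal_mul hA₀, ← ENNReal.ofReal_mul (by positivity),
        ← ENNReal.ofReal_add (by positivity) (by positivity)]
      refine ENNReal.ofReal_le_ofReal ?_
      have hq := inv_min_pow_le m (t := b * r / (2 * s)) (by positivity)
      have hq0 : 0 < min 1 (b * r / (2 * s)) := lt_min one_pos (by positivity)
      have e1 : r ^ (-(β + k)) = r ^ (-β) / r ^ k := by
        rw [neg_add', Real.rpow_sub_natCast hr0.ne']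
      have e2 : r ^ (-(β + m + k)) = r ^ (-β) / r ^ m / r ^ k := by
        rw [neg_add', neg_add', Real.rpow_sub_natCast hr0.ne', Real.rpow_sub_natCast hr0.ne']
      rw [e1, e2]
      calc _ = A * (r ^ (-β) / r ^ k) * (min 1 (b * r / (2 * s)) ^ m)⁻¹ := by
            rw [hA, mul_pow b r]; field_simp
        _ ≤ A * (r ^ (-β) / r ^ k) * (1 + ((b * r / (2 * s)) ^ m)⁻¹) := by gcongr
        _ = _ := by
            have : ((b * r / (2 * s)) ^ m)⁻¹ = (2 * ρ) ^ m / r ^ m := by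
              rw [← inv_pow, ← div_pow, hρ_def]
              congr 1; field_simp
            rw [this]; ring
    · simp [indicator_of_notMem hr]
  have hmeas : ∀ p : ℝ, Measurable fun z : EuclideanSpace ℝ (Fin k) =>
      (Ioi ρ).indicator (fun r => ENNReal.ofReal (r ^ (-(p + k)))) ‖z‖ := fun p =>
    (Measurable.indicator (by fun_prop) measurableSet_Ioi).comp measurable_norm
  refine (lintegral_mono fun z => hpt ‖z‖).trans ?_
  rw [lintegral_add_left ((hmeas β).const_mul _), lintegral_const_mul _ (hmeas β),
    lintegral_const_mul _ (hmeas (β + m))]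
  refine (add_le_add (mul_le_mul_right (setLIntegral_norm_rpow_le hk w hρ hβ₀) _)
    (mul_le_mul_right (setLIntegral_norm_rpow_le hk w hρ (by positivity : 0 < β + m)) _)).trans ?_
  rw [← ENNReal.ofReal_mul hA₀, ← ENNReal.ofReal_mul (by positivity),
    ← ENNReal.ofReal_add (by positivity) (by positivity)]
  refine ENNReal.ofReal_le_ofReal ?_
  have e1 : ρ ^ (-(β + m)) = ρ ^ (-β) / ρ ^ m := by
    rw [neg_add', Real.rpow_sub_natCast hρ.ne']
  have e2 : b ^ (β - k) = b ^ β / b ^ k := Real.rpow_sub_natCast hb₀.ne' ..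
  have e3 : ρ ^ (-β) = s ^ (-β) * b ^ β := by
    rw [hρ_def, Real.div_rpow hs.le hb₀.le, Real.rpow_neg hb₀.le, div_inv_eq_mul]
  calc _ = A * sphereArea k / 2 * ρ ^ (-β) * (1 / β + 2 ^ m / (β + m)) := by
        rw [e1, mul_pow]; field_simp
    _ ≤ A * sphereArea k / 2 * ρ ^ (-β) * (2 * 2 ^ m / ((m + k : ℕ) : ℝ)) := by
        have := one_div_add_two_pow_div_le m hk hβ
        gcongr
    _ = _ := by
        rw [e2, e3, hA, K4, Nat.add_sub_cancel_left, ← hc_def, ← hT_def, ← hκ_def]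
        field_simp

theorem mul_norm_le_of_mem_cube {R b : ℝ} (hb₀ : 0 < b) (hb : b < 1 / Real.sqrt k)
    {z : EuclideanSpace ℝ (Fin k)} (hz : z ∈ cube k R) : b * ‖z‖ ≤ R := by
  have hk : 0 < k := by
    rcases Nat.eq_zero_or_pos k with rfl | h
    · simp at hb; linarith
    · exact h
  have hk' : 0 < Real.sqrt k := Real.sqrt_pos.2 (by exact_mod_cast hk)
  calc b * ‖z‖ ≤ 1 / Real.sqrt k * (Real.sqrt k * R) := by
        have := (norm_lt_of_mem_cube hk hz).le
        gcongr
    _ = R := by field_simp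

end FlatCone

theorem corollaryC (m n : ℕ) (hmn : m < n) (R θ b β K₃ : ℝ)
    (hθ₀ : 0 < θ) (hθ : θ < Real.pi / 2)
    (hb₀ : 0 < b) (hb : b < 1 / Real.sqrt ((n : ℝ) - m))
    (hβ : (n : ℝ) - m < β)
    (γ : EuclideanSpace ℝ (Fin n) → ℝ)
    (hγ_meas : AEMeasurable γ (volume.restrict (FlatCone.box m n R)))
    (hγ_nonneg : ∀ x ∈ FlatCone.box m n R, 0 ≤ γ x)
    (hγ : ∀ x ∈ FlatCone.box m n R,
      1 ≤ Metric.infDist x (FlatCone.plane m n) ^ β * γ x ∧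
        Metric.infDist x (FlatCone.plane m n) ^ β * γ x ≤ K₃) :
    (∀ x ∈ FlatCone.box m n R,
      MeasurableSet (FlatCone.Psi m n R θ b x) ∧
      0 < volume (FlatCone.Psi m n R θ b x) ∧ volume (FlatCone.Psi m n R θ b x) < ⊤) ∧
    (0 < FlatCone.coneVol m n θ) ∧
    ∀ y ∈ FlatCone.box m n R,
      MeasurableSet (FlatCone.PsiInv m n R θ b y) ∧
      IntegrableOn (fun x => γ x / volume.real (FlatCone.Psi m n R θ b x))
        (FlatCone.PsiInv m n R θ b y) volume ∧
      ∫ x in FlatCone.PsiInv m n R θ b y, γ x / volume.real (FlatCone.Psi m n R θ b x) ≤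
        K₃ * FlatCone.K4 m n θ / n * b ^ (β - ((n : ℝ) - m)) * γ y := by
  obtain ⟨k, rfl⟩ := Nat.exists_eq_add_of_le hmn.le
  have hk : 0 < k := by omega
  have hcast : ((m + k : ℕ) : ℝ) - m = k := by push_cast; ring
  rw [hcast] at hb hβ ⊢
  have hbR : ∀ z ∈ FlatCone.cube k R, b * ‖z‖ ≤ R := fun z hz =>
    FlatCone.mul_norm_le_of_mem_cube hb₀ hb hz
  have hpos : ∀ x ∈ FlatCone.box m (m + k) R, 0 < volume (FlatCone.Psi m (m + k) R θ b x) := by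
    intro x hx
    obtain ⟨u, v, rfl⟩ := FlatCone.exists_join x
    obtain ⟨hu, hv, hv0⟩ := (FlatCone.join_mem_box u v).1 hx
    exact FlatCone.volume_Psi_pos hθ₀ hθ hb₀ hu hv0 (hbR v hv)
  refine ⟨fun x hx => ⟨FlatCone.measurableSet_Psi _ _ _ _ _ _, hpos x hx,
    FlatCone.volume_Psi_lt_top _ _ _ _ _ _⟩, FlatCone.coneVol_pos hθ₀ hθ hk, fun y hy => ?_⟩
  have hsub : FlatCone.PsiInv m (m + k) R θ b y ⊆ FlatCone.box m (m + k) R := fun x hx => hx.1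
  have hmeas := FlatCone.measurableSet_PsiInv m (m + k) R θ b y
  have hK : 0 ≤ K₃ := by linarith [(hγ y hy).1, (hγ y hy).2]
  have hnn : 0 ≤ᵐ[volume.restrict (FlatCone.PsiInv m (m + k) R θ b y)]
      fun x => γ x / volume.real (FlatCone.Psi m (m + k) R θ b x) := by
    filter_upwards [ae_restrict_mem hmeas] with x hx
    exact div_nonneg (hγ_nonneg x (hsub hx)) measureReal_nonneg
  have hae : AEStronglyMeasurable (fun x => γ x / volume.real (FlatCone.Psi m (m + k) R θ b x))
      (volume.restrict (FlatCone.PsiInv m (m + k) R θ b y)) :=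
    ((hγ_meas.mono_set hsub).div
      (FlatCone.measurable_volume_Psi m (m + k) R θ b).ennreal_toReal.aemeasurable)
      |>.aestronglyMeasurable
  obtain ⟨u, w, rfl⟩ := FlatCone.exists_join y
  obtain ⟨hu, hw, hw0⟩ := (FlatCone.join_mem_box u w).1 hy
  have hlint := FlatCone.setLIntegral_PsiInv_le_ofReal hθ₀ hθ hb₀ hbR hK hβ
    (fun x hx => (hγ x hx).2) u hw0
  refine ⟨hmeas, (lintegral_ofReal_ne_top_iff_integrable hae hnn).1
    (hlint.trans_lt ENNReal.ofReal_lt_top).ne, ?_⟩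
  have hs : 0 < ‖w‖ := norm_pos_iff.2 hw0
  have hK4 : 0 ≤ FlatCone.K4 m (m + k) θ := by
    have hT : 0 < Real.tan θ := Real.tan_pos_of_pos_of_lt_pi_div_two hθ₀ hθ
    have h1 := FlatCone.coneVol_pos (m := m) hθ₀ hθ hk
    have h2 := FlatCone.ballVol_pos m
    have h3 : 0 ≤ FlatCone.sphereArea (m + k - m) := measureReal_nonneg
    unfold FlatCone.K4
    positivity
  have hγy : ‖w‖ ^ (-β) ≤ γ (FlatCone.join (u, w)) := by
    have := (hγ _ hy).1
    rw [FlatCone.infDist_join] at this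
    rwa [Real.rpow_neg hs.le, inv_le_iff_one_le_mul₀' (by positivity)]
  rw [integral_eq_lintegral_of_nonneg_ae hnn hae]
  refine (ENNReal.toReal_le_of_le_ofReal (by positivity) hlint).trans ?_
  gcongr
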